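/- Let $n,m\ge 0$ be integers, let $f,g_1,\dots,g_m\in\mathbb{R}[x]=\mathbb{R}[x_1,\dots,x_n]$, and put $$S(g)=\{x\in\mathbb{R}^n:\ g_j(x)\ge 0,\ j=1,\dots,m\},\qquad \theta=1+\|x\|_2^2=1+x_1^2+\dots+x_n^2 .$$ $S(g)$ is not assumed to be compact. For $t\in\mathbb{Z}$ let $\Sigma[x]_t$ be the set of sums of squares of polynomials that have degree at most $2t$ (so $\Sigma[x]_t=\{0\}$ for $t<0$), and for $D\in\mathbb{N}$ let $$Q_D(g)=\Big\{\sigma_0+\sum_{j=1}^m\sigma_j g_j:\ \sigma_0\in\Sigma[x]_D,\ \sigma_j\in\Sigma[x]_{D-\lceil \deg(g_j)/2\rceil}\Big\}$$ be the truncated quadratic module of order $D$ (with the convention $\deg 0=0$). Suppose that $f\ge 0$ on $S(g)$. Let $\varepsilon>0$ be real and let $d\in\mathbb{N}$ satisfy at least one of the following conditions: (i) $d\ge 1+\lfloor \deg(f)/2\rfloor$; (ii) $d\ge\lceil \deg(f)/2\rceil$, one of the $g_j$ (say $g_m$) equals $f+\lambda$ for some real $\lambda\ge 0$, and $f$ is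 not a negative constant (the last requirement holds automatically if $S(g)\neq\emptyset$). Then there exists $k\in\mathbb{N}$ such that $$\theta^{k}\,(f+\varepsilon\,\theta^{d})\in Q_{k+d}(g).$$ -/

import Mathlib

noncomputable section

/-- The basic semialgebraic set `S(g) = {x ∈ ℝⁿ : g_j(x) ≥ 0 for j = 1, …, m}`. -/
def semialgSet {n m : ℕ} (g : Fin m → MvPolynomial (Fin n) ℝ) : Set (Fin n → ℝ) :=
  {x | ∀ j, 0 ≤ MvPolynomial.eval x (g j)}

/-- `Σ[x]_t`: the sums of squares of polynomials having degree at most `2t`. For `t < 0` only the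
zero polynomial belongs to it (this is why `t` is an integer). -/
def sosTrunc (n : ℕ) (t : ℤ) : Set (MvPolynomial (Fin n) ℝ) :=
  {σ | IsSumSq σ ∧ (σ = 0 ∨ (σ.totalDegree : ℤ) ≤ 2 * t)}

/-- `⌈deg h / 2⌉`. -/
def ceilHalfDegree {n : ℕ} (h : MvPolynomial (Fin n) ℝ) : ℕ := (h.totalDegree + 1) / 2

/-- The truncated quadratic module of order `D`:
`Q_D(g) = {σ₀ + ∑ j, σ_j g_j : σ₀ ∈ Σ[x]_D, σ_j ∈ Σ[x]_{D - ⌈deg g_j / 2⌉}}`. -/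
def truncQuadModule {n m : ℕ} (g : Fin m → MvPolynomial (Fin n) ℝ) (D : ℕ) :
    Set (MvPolynomial (Fin n) ℝ) :=
  {p | ∃ (σ₀ : MvPolynomial (Fin n) ℝ) (σ : Fin m → MvPolynomial (Fin n) ℝ),
    σ₀ ∈ sosTrunc n D ∧
    (∀ j, σ j ∈ sosTrunc n ((D : ℤ) - (ceilHalfDegree (g j) : ℤ))) ∧
    p = σ₀ + ∑ j, σ j * g j}

/-- `θ = 1 + ‖x‖₂² = 1 + x₁² + ⋯ + xₙ²`. -/
def thetaPoly (n : ℕ) : MvPolynomial (Fin n) ℝ :=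
  1 + ∑ i : Fin n, MvPolynomial.X i ^ 2

end

/-! Divide by powers of `θ` to make the problem bounded. The functions `p / θ^k` with `deg p ≤ 2k`
form an algebra, and the union of the `Q_k(g) / θ^k` is a quadratic module in it. This module is
archimedean with no compactness of `S(g)`: `N θ^k - p` is a sum of squares for large `N`
(`isThetaBounded_of_totalDegree_le`). By the archimedean Positivstellensatz (`mem_of_pos`) it
remains to see that `f / θ^d + ε` is positive at each character `φ` nonnegative on the module. If
`φ(1/θ) ≠ 0`, then `φ` is evaluation at a point of `S(g)`, where `f ≥ 0`. If `φ(1/θ) = 0`, a point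
at infinity, every `p / θ^k` with `deg p < 2k` vanishes; this settles (i), while in (ii) `f / θ^d`
agrees with `g_j / θ^d` up to the negligible `λ / θ^d` when `d > 0`. Clearing denominators gives the
certificate. -/

/-! ### Archimedean quadratic modules and their real characters. -/

/-- A quadratic module of a commutative ring. -/
structure IsQuadraticModule {A : Type*} [CommRing A] (M : Set A) : Prop where
  one_mem : 1 ∈ M
  add_mem : ∀ {a b}, a ∈ M → b ∈ M → a + b ∈ M
  sq_mul_mem : ∀ (a) {b}, b ∈ M → a * a * b ∈ M

namespace IsQuadraticModule

variable {A : Type*} [CommRing A] {M : Set A}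

theorem zero_mem (hM : IsQuadraticModule M) : 0 ∈ M := by
  simpa using hM.sq_mul_mem 0 hM.one_mem

theorem sumSq_mul_mem (hM : IsQuadraticModule M) {s b : A} (hs : IsSumSq s) (hb : b ∈ M) :
    s * b ∈ M := by
  induction hs with
  | zero => simpa using hM.zero_mem
  | sq_add a hs ih => rw [add_mul]; exact hM.add_mem (hM.sq_mul_mem a hb) ih

theorem sumSq_mem (hM : IsQuadraticModule M) {s : A} (hs : IsSumSq s) : s ∈ M := by
  simpa using hM.sumSq_mul_mem hs hM.one_mem

/-- The quadratic module generated by `M` and one more element. -/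
theorem adjoin (hM : IsQuadraticModule M) (f : A) :
    IsQuadraticModule {a | ∃ m ∈ M, ∃ s, IsSumSq s ∧ a = m + s * f} where
  one_mem := ⟨1, hM.one_mem, 0, IsSumSq.zero, by simp⟩
  add_mem := by
    rintro _ _ ⟨m, hm, s, hs, rfl⟩ ⟨m', hm', s', hs', rfl⟩
    exact ⟨m + m', hM.add_mem hm hm', s + s', hs.add hs', by ring⟩
  sq_mul_mem := by
    rintro c _ ⟨m, hm, s, hs, rfl⟩
    exact ⟨c * c * m, hM.sq_mul_mem c hm, c * c * s, (IsSumSq.mul_self c).mul hs, by ring⟩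

section Real

variable [Algebra ℝ A]

local notation "κ" => algebraMap ℝ A

theorem algebraMap_mul_mem (hM : IsQuadraticModule M) {r : ℝ} (hr : 0 ≤ r) {b : A} (hb : b ∈ M) :
    κ r * b ∈ M := by
  have := hM.sq_mul_mem (κ (√r)) hb
  rwa [← map_mul, Real.mul_self_sqrt hr] at this

theorem algebraMap_mem (hM : IsQuadraticModule M) {r : ℝ} (hr : 0 ≤ r) : κ r ∈ M := by
  simpa using hM.algebraMap_mul_mem hr hM.one_mem

theorem nonneg_of_algebraMap_mem (hM : IsQuadraticModule M) (h1 : (-1 : A) ∉ M) {r : ℝ}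
    (hr : κ r ∈ M) : 0 ≤ r := by
  by_contra! h
  apply h1
  have := hM.algebraMap_mul_mem (r := (-r)⁻¹) (by rw [inv_nonneg]; linarith) hr
  rw [← map_mul] at this
  have e : (-r)⁻¹ * r = -1 := by rw [inv_neg, neg_mul, inv_mul_cancel₀ h.ne]
  rwa [e, map_neg, map_one] at this

/-- From `4c = (c+1)² - (c-1)²`; hence `M ∩ -M` is an ideal. -/
theorem mul_mem_support (hM : IsQuadraticModule M) {a : A} (ha : a ∈ M) (ha' : -a ∈ M) (c : A) :
    c * a ∈ M := by
  have h := hM.add_mem (hM.sq_mul_mem (c + 1) ha) (hM.sq_mul_mem (c - 1) ha')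
  have h2 := hM.algebraMap_mul_mem (r := 1 / 4) (by norm_num) h
  have e : κ (1 / 4) * 4 = 1 := by
    rw [← map_ofNat κ 4, ← map_mul]; norm_num
  have : κ (1 / 4) * ((c + 1) * (c + 1) * a + (c - 1) * (c - 1) * -a) = c * a := by
    linear_combination (c * a) * e
  rwa [this] at h2

/-- A maximal proper quadratic module is total. -/
theorem mem_or_neg_mem_of_maximal (hM : IsQuadraticModule M) (h1 : (-1 : A) ∉ M)
    (hmax : ∀ N : Set A, IsQuadraticModule N → (-1 : A) ∉ N → M ⊆ N → N ⊆ M) (f : A) :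
    f ∈ M ∨ -f ∈ M := by
  have key : ∀ h : A, h ∉ M → ∃ m ∈ M, ∃ s, IsSumSq s ∧ -1 = m + s * h := by
    intro h hh
    by_contra hcon
    refine hh (hmax _ (hM.adjoin h) hcon ?_ ⟨0, hM.zero_mem, 1, IsSumSq.one, by simp⟩)
    exact fun m hm => ⟨m, hm, 0, IsSumSq.zero, by simp⟩
  by_contra! hcon
  obtain ⟨p, hp, s, hs, e1⟩ := key f hcon.1
  obtain ⟨q, hq, t, ht, e2⟩ := key (-f) hcon.2
  -- Eliminating `f` from `-1 = p + s f` and `-1 = q - t f` puts `s` in the support, so `s f ∈ M`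
  -- and then `-1 ∈ M`.
  have hs' : -s ∈ M := by
    have : t + t * p + s * q ∈ M :=
      hM.add_mem (hM.add_mem (hM.sumSq_mem ht) (hM.sumSq_mul_mem ht hp)) (hM.sumSq_mul_mem hs hq)
    have e : t + t * p + s * q = -s := by linear_combination (-t) * e1 - s * e2
    rwa [e] at this
  apply h1
  rw [e1]
  refine hM.add_mem hp ?_
  rw [mul_comm]
  exact hM.mul_mem_support (hM.sumSq_mem hs) hs' f

/-- `a` is infinitely close to the real number `r` with respect to the ordering given by `M`. -/
def IsClose (M : Set A) (a : A) (r : ℝ) : Prop :=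
  ∀ ε : ℝ, 0 < ε → a - κ r + κ ε ∈ M ∧ κ r - a + κ ε ∈ M

theorem isClose_algebraMap (hM : IsQuadraticModule M) (r : ℝ) : IsClose M (κ r) r := by
  intro ε hε
  simpa using hM.algebraMap_mem hε.le

theorem IsClose.neg {a : A} {r : ℝ} (h : IsClose M a r) : IsClose M (-a) (-r) := by
  intro ε hε
  obtain ⟨h1, h2⟩ := h ε hε
  constructor
  · convert h2 using 1; rw [map_neg]; ring
  · convert h1 using 1; rw [map_neg]; ring

theorem IsClose.add (hM : IsQuadraticModule M) {a b : A} {r s : ℝ} (h : IsClose M a r)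
    (h' : IsClose M b s) : IsClose M (a + b) (r + s) := by
  intro ε hε
  obtain ⟨h1, h2⟩ := h (ε / 2) (by linarith)
  obtain ⟨h3, h4⟩ := h' (ε / 2) (by linarith)
  have e : κ ε = κ (ε / 2) + κ (ε / 2) := by rw [← map_add]; congr 1; ring
  constructor
  · convert hM.add_mem h1 h3 using 1; rw [map_add, e]; ring
  · convert hM.add_mem h2 h4 using 1; rw [map_add, e]; ring

theorem IsClose.nonneg_smul (hM : IsQuadraticModule M) {a : A} {r : ℝ} (h : IsClose M a r)
    {c : ℝ} (hc : 0 ≤ c) : IsClose M (κ c * a) (c * r) := by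
  intro ε hε
  rcases hc.eq_or_lt with rfl | hc
  · simpa using hM.algebraMap_mem hε.le
  obtain ⟨h1, h2⟩ := h (ε / c) (by positivity)
  have e : κ ε = κ c * κ (ε / c) := by rw [← map_mul]; congr 1; field_simp
  constructor
  · convert hM.algebraMap_mul_mem hc.le h1 using 1; rw [map_mul, e]; ring
  · convert hM.algebraMap_mul_mem hc.le h2 using 1; rw [map_mul, e]; ring

theorem IsClose.smul (hM : IsQuadraticModule M) {a : A} {r : ℝ} (h : IsClose M a r)
    (c : ℝ) : IsClose M (κ c * a) (c * r) := by
  rcases le_total 0 c with hc | hc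
  · exact h.nonneg_smul hM hc
  · simpa using (h.nonneg_smul hM (neg_nonneg.2 hc)).neg

/-- `M` need not be closed under products, but with `δ = √ε` one has `2δ(δ² - a²) = (δ+a)²(δ-a) +
(δ-a)²(δ+a)`. -/
theorem IsClose.mul_self_of_zero (hM : IsQuadraticModule M) {a : A} (h : IsClose M a 0) :
    IsClose M (a * a) 0 := by
  intro ε hε
  constructor
  · simpa using hM.add_mem (hM.sq_mul_mem a hM.one_mem) (hM.algebraMap_mem hε.le)
  · have hd : 0 < √ε := Real.sqrt_pos.2 hε
    obtain ⟨h1, h2⟩ := h (√ε) hd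
    have h3 := hM.add_mem (hM.sq_mul_mem (κ (√ε) + a) h2) (hM.sq_mul_mem (κ (√ε) - a) h1)
    have h4 := hM.algebraMap_mul_mem (r := 1 / (2 * √ε)) (by positivity) h3
    convert h4 using 1
    have e1 : κ ε = κ (√ε) * κ (√ε) := by rw [← map_mul, Real.mul_self_sqrt hε.le]
    have e2 : κ (1 / (2 * √ε)) * (2 * κ (√ε)) = 1 := by
      rw [← map_ofNat κ 2, ← map_mul, ← map_mul, ← map_one κ]; congr 1; field_simp
    rw [e1, map_zero]
    linear_combination (-(κ (√ε) + a) * (κ (√ε) - a)) * e2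

/-- Polarization reduces the product of the infinitesimals `a - r` and `b - s` to squares. -/
theorem IsClose.mul (hM : IsQuadraticModule M) {a b : A} {r s : ℝ} (h : IsClose M a r)
    (h' : IsClose M b s) : IsClose M (a * b) (r * s) := by
  have shift : ∀ {c : A} {t : ℝ}, IsClose M c t → IsClose M (c - κ t) 0 := by
    intro c t hc
    simpa [sub_eq_add_neg] using hc.add hM (hM.isClose_algebraMap t).neg
  have hx := shift h
  have hy := shift h'
  have hp : IsClose M ((a - κ r + (b - κ s)) * (a - κ r + (b - κ s))) 0 :=
    IsClose.mul_self_of_zero hM (by simpa using hx.add hM hy)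
  have hq : IsClose M ((a - κ r - (b - κ s)) * (a - κ r - (b - κ s))) 0 :=
    IsClose.mul_self_of_zero hM (by simpa [sub_eq_add_neg] using hx.add hM hy.neg)
  have h2 := (hp.add hM hq.neg).smul hM (1 / 4)
  have h3 := ((h2.add hM (h'.smul hM r)).add hM (h.smul hM s)).add hM
    (hM.isClose_algebraMap (-(r * s)))
  have e : κ (1 / 4) * 4 = 1 := by
    rw [← map_ofNat κ 4, ← map_mul]; norm_num
  convert h3 using 1
  · rw [map_neg, map_mul]
    linear_combination (-(a - κ r) * (b - κ s)) * e
  · ring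

theorem IsClose.unique (hM : IsQuadraticModule M) (h1 : (-1 : A) ∉ M) {a : A} {r s : ℝ}
    (h : IsClose M a r) (h' : IsClose M a s) : r = s := by
  have key : ∀ {r s : ℝ}, IsClose M a r → IsClose M a s → r ≤ s := by
    intro r s h h'
    refine le_of_forall_pos_le_add fun ε hε => ?_
    have h2 := hM.add_mem (h (ε / 2) (by linarith)).1 (h' (ε / 2) (by linarith)).2
    have e : a - κ r + κ (ε / 2) + (κ s - a + κ (ε / 2)) = κ (s - r + ε) := by
      have e : κ ε = κ (ε / 2) + κ (ε / 2) := by rw [← map_add]; congr 1; ring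
      rw [map_add, map_sub, e]; ring
    rw [e] at h2
    linarith [hM.nonneg_of_algebraMap_mem h1 h2]
  exact le_antisymm (key h h') (key h' h)

theorem exists_isClose (hM : IsQuadraticModule M) (h1 : (-1 : A) ∉ M)
    (htot : ∀ f, f ∈ M ∨ -f ∈ M) (harch : ∀ a, ∃ N : ℝ, κ N - a ∈ M) (a : A) :
    ∃ r, IsClose M a r := by
  set S : Set ℝ := {r | a - κ r ∈ M} with hS
  obtain ⟨N, hN⟩ := harch a
  obtain ⟨N', hN'⟩ := harch (-a)
  have hne : S.Nonempty := ⟨-N', by simpa [hS, add_comm] using hN'⟩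
  have hbd : BddAbove S := by
    refine ⟨N, fun r hr => ?_⟩
    have h2 := hM.add_mem hN hr
    have e : κ N - a + (a - κ r) = κ (N - r) := by rw [map_sub]; ring
    rw [e] at h2
    linarith [hM.nonneg_of_algebraMap_mem h1 h2]
  refine ⟨sSup S, fun ε hε => ⟨?_, ?_⟩⟩
  · obtain ⟨r, hr, hlt⟩ := exists_lt_of_lt_csSup hne (sub_lt_self (sSup S) hε)
    have h2 := hM.add_mem hr (hM.algebraMap_mem (r := r - sSup S + ε) (by linarith))
    convert h2 using 1
    rw [map_add, map_sub]; ring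
  · have : sSup S + ε ∉ S := fun h => by linarith [le_csSup hbd h]
    have h2 := (htot (a - κ (sSup S + ε))).resolve_left this
    convert h2 using 1
    rw [map_add]; ring

/-- A proper total archimedean quadratic module is contained in the nonnegativity cone of a real
character. -/
theorem exists_algHom_of_total (hM : IsQuadraticModule M) (h1 : (-1 : A) ∉ M)
    (htot : ∀ f, f ∈ M ∨ -f ∈ M) (harch : ∀ a, ∃ N : ℝ, κ N - a ∈ M) :
    ∃ φ : A →ₐ[ℝ] ℝ, ∀ a ∈ M, 0 ≤ φ a := by
  choose v hv using hM.exists_isClose h1 htot harch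
  have huniq : ∀ {a r}, IsClose M a r → v a = r := fun h => (hv _).unique hM h1 h
  refine ⟨{ toFun := v
            map_one' := huniq (by simpa using hM.isClose_algebraMap 1)
            map_mul' := fun a b => huniq ((hv a).mul hM (hv b))
            map_zero' := huniq (by simpa using hM.isClose_algebraMap 0)
            map_add' := fun a b => huniq ((hv a).add hM (hv b))
            commutes' := fun r => huniq (hM.isClose_algebraMap r) }, fun a ha => ?_⟩
  change 0 ≤ v a
  refine le_of_forall_pos_le_add fun ε hε => ?_
  have h2 := hM.add_mem ha (hv a ε hε).2
  have e : a + (κ (v a) - a + κ ε) = κ (v a + ε) := by rw [map_add]; ring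
  rw [e] at h2
  exact hM.nonneg_of_algebraMap_mem h1 h2

/-- Every proper archimedean quadratic module is nonnegative on some real character. -/
theorem exists_algHom (hM : IsQuadraticModule M) (h1 : (-1 : A) ∉ M)
    (harch : ∀ a, ∃ N : ℝ, κ N - a ∈ M) : ∃ φ : A →ₐ[ℝ] ℝ, ∀ a ∈ M, 0 ≤ φ a := by
  obtain ⟨P, hMP, hP⟩ := zorn_subset_nonempty {N : Set A | IsQuadraticModule N ∧ (-1 : A) ∉ N}
    (by
      intro c hc hchain hne
      refine ⟨⋃₀ c, ⟨⟨?_, ?_, ?_⟩, ?_⟩, fun s hs => Set.subset_sUnion_of_mem hs⟩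
      · obtain ⟨N, hN⟩ := hne
        exact ⟨N, hN, (hc hN).1.one_mem⟩
      · rintro a b ⟨N, hN, ha⟩ ⟨N', hN', hb⟩
        rcases hchain.total hN hN' with h | h
        · exact ⟨N', hN', (hc hN').1.add_mem (h ha) hb⟩
        · exact ⟨N, hN, (hc hN).1.add_mem ha (h hb)⟩
      · rintro a b ⟨N, hN, hb⟩
        exact ⟨N, hN, (hc hN).1.sq_mul_mem a hb⟩
      · rintro ⟨N, hN, h⟩
        exact (hc hN).2 h) M ⟨hM, h1⟩
  obtain ⟨hPq, hP1⟩ := hP.prop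
  obtain ⟨φ, hφ⟩ := hPq.exists_algHom_of_total hP1
    (hPq.mem_or_neg_mem_of_maximal hP1 fun N hN hN1 hPN => hP.le_of_ge ⟨hN, hN1⟩ hPN)
    (fun a => (harch a).imp fun N hN => hMP hN)
  exact ⟨φ, fun a ha => hφ a (hMP ha)⟩

/-- The archimedean Positivstellensatz: an element that is positive on all real characters which
are nonnegative on an archimedean quadratic module belongs to this module. -/
theorem mem_of_pos (hM : IsQuadraticModule M) (harch : ∀ a, ∃ N : ℝ, κ N - a ∈ M) {a : A}
    (ha : ∀ φ : A →ₐ[ℝ] ℝ, (∀ m ∈ M, 0 ≤ φ m) → 0 < φ a) : a ∈ M := by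
  -- Otherwise adjoining `-a` keeps the module proper, and some character has `φ a ≤ 0`. Thus `s a =
  -- 1 + q`.
  obtain ⟨q, hq, s, hs, e⟩ : ∃ q ∈ M, ∃ s, IsSumSq s ∧ -1 = q + s * -a := by
    by_contra hcon
    obtain ⟨φ, hφ⟩ := (hM.adjoin (-a)).exists_algHom hcon fun b =>
      (harch b).imp fun N hN => ⟨_, hN, 0, IsSumSq.zero, by simp⟩
    have h0 := ha φ fun m hm => hφ m ⟨m, hm, 0, IsSumSq.zero, by simp⟩
    have h2 := hφ (-a) ⟨0, hM.zero_mem, 1, IsSumSq.one, by simp⟩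
    rw [map_neg] at h2
    linarith
  obtain ⟨N₁, hN₁⟩ := harch s
  obtain ⟨N₂, hN₂⟩ := harch (s * s * a)
  obtain ⟨N, hN1, hNs, hNa⟩ : ∃ N : ℝ, 1 ≤ N ∧ κ N - s ∈ M ∧ κ N - s * s * a ∈ M := by
    have mono : ∀ {x y : ℝ} {b : A}, x ≤ y → κ x - b ∈ M → κ y - b ∈ M := by
      intro x y b hxy hb
      convert hM.add_mem hb (hM.algebraMap_mem (sub_nonneg.2 hxy)) using 1
      rw [map_sub]; ring
    exact ⟨max 1 (max N₁ N₂), le_max_left _ _,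
      mono ((le_max_left _ _).trans (le_max_right _ _)) hN₁,
      mono ((le_max_right _ _).trans (le_max_right _ _)) hN₂⟩
  have hN0 : 0 < N := by linarith
  have hprod : s * (2 * κ N - s) ∈ M := by
    have h2 : 2 * κ N - s ∈ M := by
      convert hM.add_mem hNs (hM.algebraMap_mem hN0.le) using 1; ring
    have h3 := hM.add_mem (hM.sq_mul_mem (2 * κ N - s) (hM.sumSq_mem hs)) (hM.sq_mul_mem s h2)
    have h4 := hM.algebraMap_mul_mem (r := 1 / (2 * N)) (by positivity) h3
    convert h4 using 1
    have e2 : κ (1 / (2 * N)) * (2 * κ N) = 1 := by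
      rw [← map_ofNat κ 2, ← map_mul, ← map_mul, ← map_one κ]; congr 1; field_simp
    linear_combination (-s * (2 * κ N - s)) * e2
  -- Divide by `N²` the identity `(N-s)²(a+r) + 2Nq + (N - s²a) + r s(2N-s) = N²(a+r) - N`. The
  -- decrement `1/N` does not depend on `r`, so finitely many steps reach `a`.
  have step : ∀ r : ℝ, 0 ≤ r → a + κ r ∈ M → a + κ (r - 1 / N) ∈ M := by
    intro r hr har
    have h2 := hM.add_mem (hM.add_mem (hM.add_mem (hM.sq_mul_mem (κ N - s) har)
      (hM.algebraMap_mul_mem (r := 2 * N) (by positivity) hq)) hNa)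
      (hM.algebraMap_mul_mem hr hprod)
    have h3 := hM.algebraMap_mul_mem (r := 1 / N * (1 / N)) (by positivity) h2
    convert h3 using 1
    have e2 : κ (1 / N) * κ N = 1 := by
      rw [← map_mul, ← map_one κ]; congr 1; field_simp
    have e3 : κ (2 * N) = 2 * κ N := by rw [map_mul, map_ofNat]
    have e4 : (κ N - s) * (κ N - s) * (a + κ r) + κ (2 * N) * q + (κ N - s * s * a)
        + κ r * (s * (2 * κ N - s)) = κ N * κ N * (a + κ r) - κ N := by
      rw [e3]; linear_combination (-2 * κ N) * e
    rw [e4, map_sub, map_mul]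
    linear_combination (-(κ (1 / N) * κ N + 1) * (a + κ r) + κ (1 / N)) * e2
  obtain ⟨R, hR⟩ := harch (-a)
  have iter : ∀ k : ℕ, ∀ r : ℝ, r ≤ k * (1 / N) → a + κ r ∈ M → a ∈ M := by
    intro k
    induction k with
    | zero =>
      intro r hr har
      have := hM.add_mem har (hM.algebraMap_mem (r := -r) (by simpa using hr))
      simpa using this
    | succ k ih =>
      intro r hr har
      rcases le_total 0 r with h0 | h0
      · refine ih _ ?_ (step r h0 har)
        push_cast at hr
        linarith
      · exact ih r (h0.trans (by positivity)) har
  obtain ⟨k, hk⟩ := exists_nat_ge (R * N)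
  refine iter k R ?_ (by simpa [add_comm] using hR)
  rw [mul_one_div, le_div_iff₀ hN0]
  exact hk

end Real

end IsQuadraticModule

open MvPolynomial

/-! ### Truncated modules and sum-of-squares bounds by powers of `θ`. -/

section Truncated

variable {n m : ℕ}

theorem mem_sosTrunc_of_totalDegree_le {p : MvPolynomial (Fin n) ℝ} {t : ℕ} (hp : IsSumSq p)
    (h : p.totalDegree ≤ 2 * t) : p ∈ sosTrunc n t :=
  ⟨hp, Or.inr (by exact_mod_cast h)⟩

theorem zero_mem_sosTrunc (t : ℤ) : (0 : MvPolynomial (Fin n) ℝ) ∈ sosTrunc n t :=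
  ⟨IsSumSq.zero, Or.inl rfl⟩

theorem add_mem_sosTrunc {t : ℤ} {p q : MvPolynomial (Fin n) ℝ} (hp : p ∈ sosTrunc n t)
    (hq : q ∈ sosTrunc n t) : p + q ∈ sosTrunc n t := by
  refine ⟨hp.1.add hq.1, ?_⟩
  rcases hp.2 with rfl | h
  · simpa using hq.2
  rcases hq.2 with rfl | h'
  · simpa using Or.inr h
  · have := totalDegree_add p q
    right; omega

theorem mul_mem_sosTrunc {s t : ℤ} {p q : MvPolynomial (Fin n) ℝ} (hp : p ∈ sosTrunc n s)
    (hq : q ∈ sosTrunc n t) : p * q ∈ sosTrunc n (s + t) := by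
  refine ⟨hp.1.mul hq.1, ?_⟩
  rcases hp.2 with rfl | h
  · simp
  rcases hq.2 with rfl | h'
  · simp
  · have := totalDegree_mul p q
    right; omega

theorem C_mem_sosTrunc {r : ℝ} (hr : 0 ≤ r) (t : ℕ) :
    (C r : MvPolynomial (Fin n) ℝ) ∈ sosTrunc n t := by
  refine mem_sosTrunc_of_totalDegree_le ?_ (by simp)
  rw [← Real.mul_self_sqrt hr, C_mul]
  exact IsSumSq.mul_self _

theorem totalDegree_thetaPoly_le : (thetaPoly n).totalDegree ≤ 2 := by
  refine (totalDegree_add _ _).trans (max_le (by simp) ?_)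
  refine (totalDegree_finsetSum _ _).trans (Finset.sup_le fun i _ => ?_)
  exact (totalDegree_pow _ _).trans (by simp)

theorem thetaPoly_mem_sosTrunc : thetaPoly n ∈ sosTrunc n (1 : ℕ) := by
  refine mem_sosTrunc_of_totalDegree_le ?_ totalDegree_thetaPoly_le
  refine IsSumSq.one.add (IsSumSq.sum fun i _ => ?_)
  rw [sq]
  exact IsSumSq.mul_self _

theorem thetaPoly_pow_mem_sosTrunc (k : ℕ) : thetaPoly n ^ k ∈ sosTrunc n k := by
  induction k with
  | zero => simpa using C_mem_sosTrunc (n := n) zero_le_one 0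
  | succ k ih => rw [pow_succ]; exact_mod_cast mul_mem_sosTrunc ih thetaPoly_mem_sosTrunc

variable {g : Fin m → MvPolynomial (Fin n) ℝ}

theorem add_mem_truncQuadModule {D : ℕ} {p q : MvPolynomial (Fin n) ℝ}
    (hp : p ∈ truncQuadModule g D) (hq : q ∈ truncQuadModule g D) :
    p + q ∈ truncQuadModule g D := by
  obtain ⟨σ₀, σ, h0, h, rfl⟩ := hp
  obtain ⟨τ₀, τ, h0', h', rfl⟩ := hq
  refine ⟨σ₀ + τ₀, fun j => σ j + τ j, add_mem_sosTrunc h0 h0',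
    fun j => add_mem_sosTrunc (h j) (h' j), ?_⟩
  simp only [add_mul, Finset.sum_add_distrib]
  ring

theorem mul_mem_truncQuadModule {D k : ℕ} {p q : MvPolynomial (Fin n) ℝ}
    (hp : p ∈ sosTrunc n k) (hq : q ∈ truncQuadModule g D) :
    p * q ∈ truncQuadModule g (k + D) := by
  obtain ⟨σ₀, σ, h0, h, rfl⟩ := hq
  refine ⟨p * σ₀, fun j => p * σ j, by exact_mod_cast mul_mem_sosTrunc hp h0, fun j => ?_, ?_⟩
  · have := mul_mem_sosTrunc hp (h j)
    rwa [← add_sub_assoc, ← Nat.cast_add] at this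
  · simp only [mul_add, Finset.mul_sum, mul_assoc]

theorem mem_truncQuadModule_of_mem_sosTrunc {D : ℕ} {p : MvPolynomial (Fin n) ℝ}
    (hp : p ∈ sosTrunc n D) : p ∈ truncQuadModule g D :=
  ⟨p, 0, hp, fun _ => zero_mem_sosTrunc _, by simp⟩

theorem constraint_mem_truncQuadModule {D : ℕ} {j : Fin m} (h : ceilHalfDegree (g j) ≤ D) :
    g j ∈ truncQuadModule g D := by
  refine ⟨0, Pi.single j 1, zero_mem_sosTrunc _, fun i => ?_, ?_⟩
  · rcases eq_or_ne i j with rfl | hij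
    · rw [Pi.single_eq_same]
      exact ⟨IsSumSq.one, Or.inr (by rw [totalDegree_one]; push_cast; omega)⟩
    · rw [Pi.single_eq_of_ne hij]
      exact zero_mem_sosTrunc _
  · simp [Pi.single_apply]

/-- Polynomials `p` such that `N θ^k ± p` are sums of squares of degree at most `2k` for some
real `N`. -/
def IsThetaBounded (k : ℕ) (p : MvPolynomial (Fin n) ℝ) : Prop :=
  ∃ N : ℝ, C N * thetaPoly n ^ k - p ∈ sosTrunc n k ∧ C N * thetaPoly n ^ k + p ∈ sosTrunc n k

theorem IsThetaBounded.add {k : ℕ} {p q : MvPolynomial (Fin n) ℝ} (hp : IsThetaBounded k p)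
    (hq : IsThetaBounded k q) : IsThetaBounded k (p + q) := by
  obtain ⟨N, h1, h2⟩ := hp
  obtain ⟨N', h1', h2'⟩ := hq
  refine ⟨N + N', ?_, ?_⟩
  · convert add_mem_sosTrunc h1 h1' using 1; rw [C_add]; ring
  · convert add_mem_sosTrunc h2 h2' using 1; rw [C_add]; ring

/-- `2(AB - pq) = (A-p)(B+q) + (A+p)(B-q)`, and likewise for `AB + pq`. -/
theorem IsThetaBounded.mul {k l : ℕ} {p q : MvPolynomial (Fin n) ℝ} (hp : IsThetaBounded k p)
    (hq : IsThetaBounded l q) : IsThetaBounded (k + l) (p * q) := by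
  obtain ⟨N, h1, h2⟩ := hp
  obtain ⟨N', h1', h2'⟩ := hq
  have half : ∀ {r s : MvPolynomial (Fin n) ℝ}, r ∈ sosTrunc n ((k : ℤ) + l) →
      C (1 / 2) * r = s → s ∈ sosTrunc n ((k + l : ℕ) : ℤ) := by
    rintro r _ hr rfl
    simpa using mul_mem_sosTrunc (C_mem_sosTrunc (n := n) (r := 1 / 2) (by norm_num) 0) hr
  have e : (C (1 / 2) * 2 : MvPolynomial (Fin n) ℝ) = 1 := by
    rw [← map_ofNat (C : ℝ →+* MvPolynomial (Fin n) ℝ) 2, ← C_mul]; norm_num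
  refine ⟨N * N', half (add_mem_sosTrunc (mul_mem_sosTrunc h1 h2') (mul_mem_sosTrunc h2 h1')) ?_,
    half (add_mem_sosTrunc (mul_mem_sosTrunc h1 h1') (mul_mem_sosTrunc h2 h2')) ?_⟩
  · rw [C_mul, pow_add]
    linear_combination (C N * thetaPoly n ^ k * (C N' * thetaPoly n ^ l) - p * q) * e
  · rw [C_mul, pow_add]
    linear_combination (C N * thetaPoly n ^ k * (C N' * thetaPoly n ^ l) + p * q) * e

theorem isThetaBounded_C (r : ℝ) : IsThetaBounded 0 (C r : MvPolynomial (Fin n) ℝ) := by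
  refine ⟨|r|, ?_, ?_⟩
  · rw [pow_zero, mul_one, ← C_sub]
    exact C_mem_sosTrunc (sub_nonneg.2 (le_abs_self r)) 0
  · rw [pow_zero, mul_one, ← C_add]
    exact C_mem_sosTrunc (by linarith [neg_abs_le r]) 0

/-- The homogeneous coordinates `1, x₁, …, xₙ`. -/
noncomputable def projCoord (n : ℕ) (o : Option (Fin n)) : MvPolynomial (Fin n) ℝ := o.elim 1 X

theorem thetaPoly_eq_sum : thetaPoly n = ∑ o, projCoord n o * projCoord n o := by
  simp [thetaPoly, projCoord, Fintype.sum_option, sq]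

theorem totalDegree_projCoord_le (o : Option (Fin n)) : (projCoord n o).totalDegree ≤ 1 := by
  cases o <;> simp [projCoord]

theorem thetaPoly_sub_projCoord_sq_isSumSq (o : Option (Fin n)) :
    IsSumSq (thetaPoly n - projCoord n o * projCoord n o) := by
  rw [thetaPoly_eq_sum, ← Finset.sum_erase_eq_sub (Finset.mem_univ o)]
  exact IsSumSq.sum fun i _ => IsSumSq.mul_self _

/-- For coordinates `y`, `y'`: `2(θ ∓ yy') = (y ∓ y')² + (θ - y²) + (θ - y'²)`. -/
theorem isThetaBounded_projCoord_mul (o o' : Option (Fin n)) :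
    IsThetaBounded 1 (projCoord n o * projCoord n o') := by
  have hdeg : (projCoord n o * projCoord n o').totalDegree ≤ 2 :=
    (totalDegree_mul _ _).trans
      (add_le_add (totalDegree_projCoord_le o) (totalDegree_projCoord_le o'))
  have hθ : (C 1 * thetaPoly n ^ 1).totalDegree ≤ 2 := by
    simpa using totalDegree_thetaPoly_le
  have hhalf : IsSumSq (C (1 / 2) : MvPolynomial (Fin n) ℝ) :=
    (C_mem_sosTrunc (by norm_num) 0).1
  have e : (C (1 / 2) * 2 : MvPolynomial (Fin n) ℝ) = 1 := by
    rw [← map_ofNat (C : ℝ →+* MvPolynomial (Fin n) ℝ) 2, ← C_mul]; norm_num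
  have h0 := (thetaPoly_sub_projCoord_sq_isSumSq o).add (thetaPoly_sub_projCoord_sq_isSumSq o')
  refine ⟨1, mem_sosTrunc_of_totalDegree_le ?_ ?_, mem_sosTrunc_of_totalDegree_le ?_ ?_⟩
  · refine (congrArg IsSumSq ?_).mp
      (hhalf.mul ((IsSumSq.mul_self (projCoord n o - projCoord n o')).add h0))
    rw [C_1]
    linear_combination (thetaPoly n - projCoord n o * projCoord n o') * e
  · exact (totalDegree_sub _ _).trans (max_le hθ hdeg)
  · refine (congrArg IsSumSq ?_).mp
      (hhalf.mul ((IsSumSq.mul_self (projCoord n o + projCoord n o')).add h0))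
    rw [C_1]
    linear_combination (thetaPoly n + projCoord n o * projCoord n o') * e
  · exact (totalDegree_add _ _).trans (max_le hθ hdeg)

/-- The coordinate `1` pads low degrees, so a monomial of degree at most `2k` splits into `k`
products of two coordinates. -/
theorem exists_monomial_eq_projCoord_mul {k : ℕ} {s : Fin n →₀ ℕ} (hs : s.degree ≤ k + 1) :
    ∃ (o : Option (Fin n)) (t : Fin n →₀ ℕ), t.degree ≤ k ∧
      (monomial s 1 : MvPolynomial (Fin n) ℝ) = projCoord n o * monomial t 1 := by
  by_cases h : s = 0
  · exact ⟨none, 0, by simp, by simp [h, projCoord]⟩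
  · obtain ⟨i, hi⟩ : ∃ i, s i ≠ 0 := by
      by_contra! hcon
      exact h (Finsupp.ext hcon)
    have hle : Finsupp.single i 1 ≤ s := by
      rw [Finsupp.single_le_iff]; omega
    have e : Finsupp.single i 1 + (s - Finsupp.single i 1) = s := add_tsub_cancel_of_le hle
    refine ⟨some i, s - Finsupp.single i 1, ?_, ?_⟩
    · have := congrArg Finsupp.degree e
      rw [map_add, Finsupp.degree_single] at this
      omega
    · simp only [projCoord, Option.elim, X, monomial_mul, e, mul_one]

theorem isThetaBounded_monomial (k : ℕ) (s : Fin n →₀ ℕ) (hs : s.degree ≤ 2 * k) :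
    IsThetaBounded k (monomial s (1 : ℝ)) := by
  induction k generalizing s with
  | zero =>
    have : s = 0 := by
      rw [← Finsupp.degree_eq_zero_iff]; omega
    subst this
    exact isThetaBounded_C 1
  | succ k ih =>
    obtain ⟨o, t, ht, e⟩ := exists_monomial_eq_projCoord_mul (k := 2 * k + 1) hs
    obtain ⟨o', t', ht', e'⟩ := exists_monomial_eq_projCoord_mul ht
    rw [e, e', ← mul_assoc, add_comm k 1]
    exact (isThetaBounded_projCoord_mul o o').mul (ih t' ht')

theorem isThetaBounded_of_totalDegree_le {k : ℕ} {p : MvPolynomial (Fin n) ℝ}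
    (hp : p.totalDegree ≤ 2 * k) : IsThetaBounded k p := by
  rw [p.as_sum]
  refine Finset.sum_induction _ (IsThetaBounded k) (fun _ _ => IsThetaBounded.add) ?_ ?_
  · simpa using (isThetaBounded_C (n := n) 0).mul (isThetaBounded_monomial k 0 (by simp))
  · intro s hs
    have h := (isThetaBounded_C (p.coeff s)).mul (isThetaBounded_monomial k s
      ((le_totalDegree hs).trans hp))
    rwa [zero_add, C_mul_monomial, mul_one] at h

end Truncated

/-! ### The algebra of fractions `p / θ^k` and its characters. -/

section ThetaFractions

variable {n m : ℕ}

theorem eval_thetaPoly_pos (x : Fin n → ℝ) : 0 < eval x (thetaPoly n) := by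
  simp only [thetaPoly, map_add, map_one, map_sum, map_pow, eval_X]
  positivity

/-- `a` is the function `p / θ^k`. -/
def IsThetaFrac (a : (Fin n → ℝ) → ℝ) (k : ℕ) (p : MvPolynomial (Fin n) ℝ) : Prop :=
  ∀ x, a x * eval x (thetaPoly n) ^ k = eval x p

namespace IsThetaFrac

variable {a b : (Fin n → ℝ) → ℝ} {k l : ℕ} {p q : MvPolynomial (Fin n) ℝ}

theorem mul (ha : IsThetaFrac a k p) (hb : IsThetaFrac b l q) :
    IsThetaFrac (a * b) (k + l) (p * q) := by
  intro x
  rw [map_mul, ← ha x, ← hb x, Pi.mul_apply, pow_add]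
  ring

theorem add_same (ha : IsThetaFrac a k p) (hb : IsThetaFrac b k q) :
    IsThetaFrac (a + b) k (p + q) := by
  intro x
  rw [map_add, ← ha x, ← hb x, Pi.add_apply]
  ring

theorem raise (ha : IsThetaFrac a k p) (l : ℕ) :
    IsThetaFrac a (l + k) (thetaPoly n ^ l * p) := by
  intro x
  rw [map_mul, ← ha x, map_pow, pow_add]
  ring

theorem add (ha : IsThetaFrac a k p) (hb : IsThetaFrac b l q) :
    IsThetaFrac (a + b) (l + k) (thetaPoly n ^ l * p + thetaPoly n ^ k * q) :=
  (ha.raise l).add_same (add_comm k l ▸ hb.raise k)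

theorem unique (ha : IsThetaFrac a k p) (hb : IsThetaFrac b k p) : a = b :=
  funext fun x => mul_right_cancel₀ (pow_pos (eval_thetaPoly_pos x) k).ne'
    ((ha x).trans (hb x).symm)

theorem const (r : ℝ) : IsThetaFrac (algebraMap ℝ ((Fin n → ℝ) → ℝ) r) 0 (C r) := by
  intro x; simp

end IsThetaFrac

/-- The algebra of the functions `p / θ^k` with `deg p ≤ 2k`. -/
def thetaFracAlgebra (n : ℕ) : Subalgebra ℝ ((Fin n → ℝ) → ℝ) where
  carrier := {a | ∃ k p, p.totalDegree ≤ 2 * k ∧ IsThetaFrac a k p}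
  mul_mem' := by
    rintro a b ⟨k, p, hp, ha⟩ ⟨l, q, hq, hb⟩
    exact ⟨k + l, p * q, (totalDegree_mul _ _).trans (by omega), ha.mul hb⟩
  add_mem' := by
    rintro a b ⟨k, p, hp, ha⟩ ⟨l, q, hq, hb⟩
    have key : ∀ (i j : ℕ) (r : MvPolynomial (Fin n) ℝ), r.totalDegree ≤ 2 * j →
        (thetaPoly n ^ i * r).totalDegree ≤ 2 * (i + j) := by
      intro i j r hr
      have h1 := totalDegree_mul (thetaPoly n ^ i) r
      have h2 := totalDegree_pow (thetaPoly n) i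
      have h3 := Nat.mul_le_mul_left i (totalDegree_thetaPoly_le (n := n))
      omega
    refine ⟨l + k, _, (totalDegree_add _ _).trans (max_le (key l k p hp) ?_), ha.add hb⟩
    rw [add_comm l k]
    exact key k l q hq
  algebraMap_mem' r := ⟨0, C r, by simp, IsThetaFrac.const r⟩

theorem exists_isThetaFrac {k : ℕ} {p : MvPolynomial (Fin n) ℝ} (hp : p.totalDegree ≤ 2 * k) :
    ∃ a : thetaFracAlgebra n, IsThetaFrac a.1 k p := by
  have h : IsThetaFrac (fun x => eval x p / eval x (thetaPoly n) ^ k) k p := fun x =>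
    div_mul_cancel₀ _ (pow_pos (eval_thetaPoly_pos x) k).ne'
  exact ⟨⟨_, k, p, hp, h⟩, h⟩

/-- The union of the sets `Q_k(g) / θ^k`. -/
def thetaQuadModule (g : Fin m → MvPolynomial (Fin n) ℝ) : Set (thetaFracAlgebra n) :=
  {a | ∃ k, ∃ q ∈ truncQuadModule g k, IsThetaFrac a.1 k q}

theorem thetaQuadModule_isQuadraticModule (g : Fin m → MvPolynomial (Fin n) ℝ) :
    IsQuadraticModule (thetaQuadModule g) where
  one_mem := ⟨0, 1, mem_truncQuadModule_of_mem_sosTrunc (C_mem_sosTrunc zero_le_one 0),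
    by simpa using IsThetaFrac.const (n := n) 1⟩
  add_mem := by
    rintro a b ⟨k, p, hp, ha⟩ ⟨l, q, hq, hb⟩
    refine ⟨l + k, _, add_mem_truncQuadModule ?_ ?_, ha.add hb⟩
    · exact mul_mem_truncQuadModule (thetaPoly_pow_mem_sosTrunc l) hp
    · rw [add_comm l k]
      exact mul_mem_truncQuadModule (thetaPoly_pow_mem_sosTrunc k) hq
  sq_mul_mem := by
    rintro a b ⟨k, q, hq, hb⟩
    obtain ⟨l, p, hp, ha⟩ := a.2
    refine ⟨l + l + k, p * p * q, mul_mem_truncQuadModule ?_ hq, (ha.mul ha).mul hb⟩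
    exact mem_sosTrunc_of_totalDegree_le (IsSumSq.mul_self p)
      ((totalDegree_mul _ _).trans (by omega))

theorem thetaQuadModule_archimedean (g : Fin m → MvPolynomial (Fin n) ℝ)
    (a : thetaFracAlgebra n) :
    ∃ N : ℝ, algebraMap ℝ (thetaFracAlgebra n) N - a ∈ thetaQuadModule g := by
  obtain ⟨k, p, hp, ha⟩ := a.2
  obtain ⟨N, hN, -⟩ := isThetaBounded_of_totalDegree_le hp
  refine ⟨N, k, _, mem_truncQuadModule_of_mem_sosTrunc hN, fun x => ?_⟩
  rw [map_sub, ← ha x, map_mul, map_pow, eval_C, ← sub_mul]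
  rfl

/-- A character with `φ(1/θ) ≠ 0` is the evaluation at a point. -/
theorem exists_point_of_algHom (φ : thetaFracAlgebra n →ₐ[ℝ] ℝ) {u : thetaFracAlgebra n}
    (hu : IsThetaFrac u.1 1 1) (hφ : φ u ≠ 0) :
    ∃ x : Fin n → ℝ, ∀ (a : thetaFracAlgebra n) (k : ℕ) (p : MvPolynomial (Fin n) ℝ),
      IsThetaFrac a.1 k p → φ a = φ u ^ k * eval x p := by
  have hv : ∀ i : Fin n, ∃ v : thetaFracAlgebra n, IsThetaFrac v.1 1 (X i) :=
    fun i => exists_isThetaFrac (by simp)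
  choose v hv using hv
  have hupow : ∀ l : ℕ, IsThetaFrac (u ^ l).1 l 1 := by
    intro l x
    have := hu x
    rw [map_one, pow_one] at this
    change u.1 x ^ l * _ = _
    rw [← mul_pow, this, one_pow, map_one]
  refine ⟨fun i => φ (v i) / φ u, ?_⟩
  -- One denominator exponent `l` per polynomial suffices: two fractions of the same `p` agree after
  -- multiplication by powers of `u = 1/θ`, and `φ u` cancels.
  have key : ∀ p : MvPolynomial (Fin n) ℝ, ∃ (l : ℕ) (a : thetaFracAlgebra n),
      IsThetaFrac a.1 l p ∧ φ a = φ u ^ l * eval (fun i => φ (v i) / φ u) p := by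
    intro p
    induction p using MvPolynomial.induction_on with
    | C r => exact ⟨0, algebraMap ℝ _ r, IsThetaFrac.const r, by simp⟩
    | add p q ihp ihq =>
      obtain ⟨k, a, ha, ha'⟩ := ihp
      obtain ⟨l, b, hb, hb'⟩ := ihq
      refine ⟨k + l, a * u ^ l + b * u ^ k, ?_, ?_⟩
      · have h1 := ha.mul (hupow l)
        have h2 := hb.mul (hupow k)
        rw [add_comm l k] at h2
        rw [mul_one] at h1 h2
        exact h1.add_same h2
      · simp only [map_add, map_mul, map_pow, ha', hb']
        ring
    | mul_X p i ih =>
      obtain ⟨l, a, ha, ha'⟩ := ih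
      refine ⟨l + 1, a * v i, ha.mul (hv i), ?_⟩
      rw [map_mul, map_mul, ha', eval_X]
      field_simp
      ring
  intro b k p hb
  obtain ⟨l, a, ha, ha'⟩ := key p
  have h1 := hb.mul (hupow l)
  have h2 := ha.mul (hupow k)
  rw [add_comm l k] at h2
  have e : b * u ^ l = a * u ^ k := Subtype.ext (h1.unique h2)
  have e' := congrArg φ e
  simp only [map_mul, map_pow, ha'] at e'
  refine mul_right_cancel₀ (pow_ne_zero l hφ) (e'.trans ?_)
  ring

/-- `(p/θ^k)² = (p²/θ^(2k-1)) · (1/θ)`, and `deg p ≤ 2k - 1` keeps the first factor in the algebra.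
-/
theorem algHom_eq_zero_of_totalDegree_lt (φ : thetaFracAlgebra n →ₐ[ℝ] ℝ)
    {u : thetaFracAlgebra n} (hu : IsThetaFrac u.1 1 1) (hφ : φ u = 0) {k : ℕ}
    {p : MvPolynomial (Fin n) ℝ} (hp : p.totalDegree < 2 * k) {a : thetaFracAlgebra n}
    (ha : IsThetaFrac a.1 k p) : φ a = 0 := by
  obtain ⟨b, hb⟩ := exists_isThetaFrac (k := k + k - 1) (p := p * p)
    ((totalDegree_mul _ _).trans (by omega))
  have h := hb.mul hu
  rw [mul_one, Nat.sub_add_cancel (by omega)] at h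
  have e : a * a = b * u := Subtype.ext ((ha.mul ha).unique h)
  have e' := congrArg φ e
  rw [map_mul, map_mul, hφ, mul_zero] at e'
  exact mul_self_eq_zero.1 e'

/-- Characters which are nonnegative on `thetaQuadModule g` are nonnegative on `f / θ^d`. -/
theorem algHom_nonneg (g : Fin m → MvPolynomial (Fin n) ℝ)
    (f : MvPolynomial (Fin n) ℝ) (hf : ∀ x ∈ semialgSet g, 0 ≤ eval x f) (d : ℕ)
    (hd : f.totalDegree < 2 * d ∨ (f.totalDegree ≤ 2 * d ∧
        (∃ (j : Fin m) (lam : ℝ), 0 ≤ lam ∧ g j = f + C lam) ∧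
        ¬ ∃ c : ℝ, c < 0 ∧ f = C c))
    (φ : thetaFracAlgebra n →ₐ[ℝ] ℝ) (hφ : ∀ a ∈ thetaQuadModule g, 0 ≤ φ a)
    {a : thetaFracAlgebra n} (ha : IsThetaFrac a.1 d f) : 0 ≤ φ a := by
  obtain ⟨u, hu⟩ := exists_isThetaFrac (n := n) (k := 1) (p := 1) (by simp)
  have hu0 : 0 ≤ φ u := hφ u ⟨1, 1,
    mem_truncQuadModule_of_mem_sosTrunc (C_mem_sosTrunc zero_le_one 1), hu⟩
  rcases hu0.eq_or_lt with h0 | hpos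
  · rcases hd with hd | ⟨hd, ⟨j, lam, hlam, hj⟩, hc⟩
    · exact (algHom_eq_zero_of_totalDegree_lt φ hu h0.symm hd ha).ge
    -- For `d = 0` the term `λ / θ^d` does not vanish at infinity; here `f` is constant and the
    -- exclusion of negative constants is needed.
    · rcases Nat.eq_zero_or_pos d with rfl | hdpos
      · have hfC : f = C (f.coeff 0) := totalDegree_eq_zero_iff_eq_C.1 (by omega)
        have e : a = algebraMap ℝ _ (f.coeff 0) := by
          refine Subtype.ext (ha.unique ?_)
          have := IsThetaFrac.const (n := n) (f.coeff 0)
          rwa [← hfC] at this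
        rw [e, AlgHom.commutes]
        by_contra! hneg
        exact hc ⟨_, hneg, hfC⟩
      · obtain ⟨b, hb⟩ := exists_isThetaFrac (n := n) (k := d) (p := C lam) (by simp)
        have hb0 := algHom_eq_zero_of_totalDegree_lt φ hu h0.symm
          (by rw [totalDegree_C]; omega) hb
        have hg : (g j).totalDegree ≤ 2 * d := by
          rw [hj]
          exact (totalDegree_add _ _).trans (max_le hd (by simp))
        have hab : a + b ∈ thetaQuadModule g := by
          refine ⟨d, g j, constraint_mem_truncQuadModule ?_, ?_⟩
          · unfold ceilHalfDegree; omega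
          · rw [hj]; exact ha.add_same hb
        have := hφ _ hab
        rwa [map_add, hb0, add_zero] at this
  · obtain ⟨x, hx⟩ := exists_point_of_algHom φ hu hpos.ne'
    rw [hx a d f ha]
    -- The point lies in `S(g)` because each `g_j / θ^⌈deg g_j / 2⌉` belongs to the module.
    refine mul_nonneg (pow_nonneg hu0 d) (hf x fun j => ?_)
    have hdeg : (g j).totalDegree ≤ 2 * ceilHalfDegree (g j) := by
      unfold ceilHalfDegree; omega
    obtain ⟨b, hb⟩ := exists_isThetaFrac hdeg
    have h := hφ b ⟨_, _, constraint_mem_truncQuadModule le_rfl, hb⟩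
    rw [hx b _ _ hb] at h
    exact nonneg_of_mul_nonneg_right h (pow_pos hpos _)

end ThetaFractions

/-! ### The main theorem. -/

/-- Condition (i) is `d ≥ 1 + ⌊deg f / 2⌋`; condition (ii) is `d ≥ ⌈deg f / 2⌉` together with one of
the constraints being `f + lam`, `lam ≥ 0`, where `f` is not a negative constant (automatic when
`S(g)` is nonempty, as `f ≥ 0` on `S(g)`). -/
theorem mainTheorem1 (n m : ℕ) (g : Fin m → MvPolynomial (Fin n) ℝ)
    (f : MvPolynomial (Fin n) ℝ)
    (hf : ∀ x ∈ semialgSet g, 0 ≤ MvPolynomial.eval x f)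
    (ε : ℝ) (hε : 0 < ε) (d : ℕ)
    (hd : 1 + f.totalDegree / 2 ≤ d ∨
      (ceilHalfDegree f ≤ d ∧
        (∃ (j : Fin m) (lam : ℝ), 0 ≤ lam ∧ g j = f + MvPolynomial.C lam) ∧
        ¬ ∃ c : ℝ, c < 0 ∧ f = MvPolynomial.C c)) :
    ∃ k : ℕ, thetaPoly n ^ k * (f + MvPolynomial.C ε * thetaPoly n ^ d)
      ∈ truncQuadModule g (k + d) := by

  have hd' : f.totalDegree < 2 * d ∨ (f.totalDegree ≤ 2 * d ∧
      (∃ (j : Fin m) (lam : ℝ), 0 ≤ lam ∧ g j = f + C lam) ∧ ¬ ∃ c : ℝ, c < 0 ∧ f = C c) := by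
    rcases hd with h | ⟨h, h'⟩
    · left; omega
    · right
      refine ⟨?_, h'⟩
      unfold ceilHalfDegree at h
      omega
  obtain ⟨a, ha⟩ := exists_isThetaFrac (k := d) (p := f) (by rcases hd' with h | h <;> omega)
  obtain ⟨k, q, hq, hk⟩ : a + algebraMap ℝ _ ε ∈ thetaQuadModule g := by
    refine (thetaQuadModule_isQuadraticModule g).mem_of_pos (thetaQuadModule_archimedean g) ?_
    intro φ hφ
    have := algHom_nonneg g f hf d hd' φ hφ ha
    rw [map_add, AlgHom.commutes]
    exact add_pos_of_nonneg_of_pos this hε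
  refine ⟨k, ?_⟩
  -- Cross-multiplied form of `f/θ^d + ε = q/θ^k`; the factor `θ^d` lifts `q` from order `k` to `k +
  -- d`.
  have e : thetaPoly n ^ k * (f + C ε * thetaPoly n ^ d) = thetaPoly n ^ d * q := by
    refine MvPolynomial.funext fun x => ?_
    have h : (a.1 x + ε) * eval x (thetaPoly n) ^ k = eval x q := hk x
    simp only [map_mul, map_add, map_pow, eval_C, ← h, ← ha x]
    ring
  rw [e, add_comm k d]
  exact mul_mem_truncQuadModule (thetaPoly_pow_mem_sosTrunc d) hq
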